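/- **Model.** An MPC protocol has $M$ machines, each with $S$ words of local memory. A word takes one of $W$ values. The input is a finite set of records (for a graph problem: one record per edge), distributed arbitrarily among the machines, subject only to at most $L \le S$ records per machine, where $L$ is a parameter of the protocol and $ML$ is at least the number of records. Computation is in synchronous rounds; in a round each machine performs an arbitrary computation on its local memory and then sends one-word messages to other machines, so that each machine sends at most $S$ and receives at most $S$ words. The machines may use a common random string (uniform on a finite set). A designated machine announces a yes/no answer, and the number of rounds is the number of communication rounds before the announcement. A family of protocols for graphs on $n$ vertices (labelled $0,\dots,n-1$) is said to have *local memory $O(n^\delta)$* if $S = O(n^\delta)$, $M = n^{O(1)}$ and $W = n^{O(1)}$ (words of $O(\log n)$ bits). It *solves* a decision problem within $r(I)$ rounds, for a function $r$ from inputs to $\mathbb N$, if for some constant $a>0$, for every input $I$ with $n$ vertices and every admissible distribution of $I$ among the machines, with probability at least $1-n^{-a}$ the correct answer is announced within $r(I)$ rounds, without violation of the bandwidth bounds. **1-vs-2-cycle conjecture.** Let $0<\delta<1$ be any constant. Distinguishing one cycle of length $n$ from two vertex-disjoint cycles of length $n/2$ ($n$ even) requires $\Omega(\log n)$ rounds with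 local memory $O(n^\delta)$: if a family of protocols with local memory $O(n^\delta)$ solves this problem within $r(G)$ rounds, then there is $c>0$ such that for every sufficiently large even $n$ some input $G$ on $n$ vertices has $r(G)\ge c\log n$. **Theorem.** Assume the 1-vs-2-cycle conjecture. Let $0<\delta<1$ and $\kappa\in\mathbb N$ be constants. Consider inputs $I=(G,w,T)$, where $G=(V,E)$ is a simple graph with $n$ vertices, $w:E\to\{0,1,\dots,n^\kappa\}$ are edge weights, and $T\subseteq E$ is a set of $n-1$ edges; each edge is given with its weight and with a bit telling whether it is in $T$. Let $D_T$ be the diameter of $T$, that is, the largest distance in $T$ between two vertices of the same component of $(V,T)$. Then deciding whether $T$ is a minimum spanning forest of $G$ requires $\Omega(\log D_T)$ rounds on an MPC with local memory $O(n^\delta)$. Precisely: if a family of protocols, one for each number $n$ of vertices and $m$ of edges, has local memory $O(n^\delta)$ (with the bounds on $S$, $M$, $W$ uniform in $m \le n^2$) and solves this problem within $r(I)$ rounds, then there is a constant $c>0$ such that for every sufficiently large $d$ there is an input $I$ with $n\le 3d$ vertices, with $D_T\ge d$ and with $r(I)\ge c\log D_T$. In particular, no such family solves the problem in $o(\log D_T)$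 rounds. -/

import Mathlib

open Filter

/-- A randomized protocol for the Massively Parallel Computation model, whose input is a finite set
of records of type `ρ`.

There are `machines` machines; each has `memory` words of local memory, and a word takes one of
`wordSize` values. At most `load` input records are placed on a machine before the computation
starts. The random string `ω` is uniform on `Fin seeds`, and all machines can read it. Local
computation is an arbitrary function of the local memory (and of `ω` and the round number). -/
structure Protocol (ρ : Type) where
  machines : ℕ
  memory : ℕ
  wordSize : ℕ
  load : ℕ
  load_le_memory : load ≤ memory
  seeds : ℕ
  seeds_pos : 0 < seeds
  /-- The memory of a machine once it has read the input records placed on it. -/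
  init : Fin seeds → Fin machines → Finset ρ → (Fin memory → Fin wordSize)
  /-- The one-word messages, with their addressees, that a machine sends in round `t`. -/
  send : Fin seeds → (t : ℕ) → Fin machines → (Fin memory → Fin wordSize) →
    List (Fin machines × Fin wordSize)
  /-- The memory of a machine after round `t`, from its memory before the round and from the words
  that it received in the round from each of the machines. -/
  next : Fin seeds → (t : ℕ) → Fin machines → (Fin memory → Fin wordSize) →
    (Fin machines → List (Fin wordSize)) → (Fin memory → Fin wordSize)
  /-- The machine that announces the answer. -/
  root : Fin machines
  /-- The answer announced after `t` rounds, if any. -/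
  answer : Fin seeds → (t : ℕ) → (Fin memory → Fin wordSize) → Option Bool

namespace Protocol

variable {ρ : Type} (P : Protocol ρ)

/-- The contents of the local memory of one machine. -/
abbrev Mem : Type := Fin P.memory → Fin P.wordSize

/-- The words received by machine `i` from machine `j` in round `t`, if the memories before the
round are `c`. -/
def inbox (ω : Fin P.seeds) (t : ℕ) (c : Fin P.machines → P.Mem) (i j : Fin P.machines) :
    List (Fin P.wordSize) :=
  ((P.send ω t j (c j)).filter (fun a => a.1 = i)).map Prod.snd

/-- The memories of all machines after `t` rounds, when machine `i` starts with the records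
`x i`. -/
def config (ω : Fin P.seeds) (x : Fin P.machines → Finset ρ) : ℕ → Fin P.machines → P.Mem
  | 0 => fun i => P.init ω i (x i)
  | t + 1 => fun i =>
      P.next ω t i (config ω x t i) (P.inbox ω t (config ω x t) i)

/-- In round `t` every machine sends at most `memory` words and receives at most `memory` words. -/
def RespectsBandwidth (ω : Fin P.seeds) (x : Fin P.machines → Finset ρ) (t : ℕ) : Prop :=
  ∀ i : Fin P.machines,
    (P.send ω t i (P.config ω x t i)).length ≤ P.memory ∧
    ∑ j, (P.inbox ω t (P.config ω x t) i j).length ≤ P.memory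

/-- On the random string `ω` and the distributed input `x`, the first answer announced is `b`, it
is announced after at most `r` rounds, and no machine exceeds its bandwidth until then. -/
def AnswersWithin (ω : Fin P.seeds) (x : Fin P.machines → Finset ρ) (r : ℕ) (b : Bool) : Prop :=
  ∃ t ≤ r,
    (∀ s < t, P.RespectsBandwidth ω x s ∧ P.answer ω s (P.config ω x s P.root) = none) ∧
    P.answer ω t (P.config ω x t P.root) = some b

/-- The part of the input `X` on machine `i` when each record `e` is placed on machine `f e`. -/
def share (X : Finset ρ) (f : ρ → Fin P.machines) (i : Fin P.machines) : Finset ρ :=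
  X.filter (fun e => f e = i)

open Classical in
/-- The machines have room for the input `X`, and for every distribution of `X` among them the
protocol correctly decides whether `Q` holds, within `r` rounds, with probability at least
`1 - ε`. -/
def Decides (X : Finset ρ) (Q : Prop) (r : ℕ) (ε : ℝ) : Prop :=
  X.card ≤ P.machines * P.load ∧
  ∀ f : ρ → Fin P.machines, (∀ i, (P.share X f i).card ≤ P.load) →
    1 - ε ≤
      ((Finset.univ.filter
          (fun ω : Fin P.seeds => P.AnswersWithin ω (P.share X f) r (decide Q))).card : ℝ)
        / P.seeds

/-- The protocol uses at most `C * n ^ δ` words of local memory, at most `C * n ^ k` machines, and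
words that take at most `C * n ^ k` values (that is, words of `O(log n)` bits). -/
def WithinResources (δ : ℝ) (C k n : ℕ) : Prop :=
  (P.memory : ℝ) ≤ C * (n : ℝ) ^ δ ∧ P.machines ≤ C * n ^ k ∧ P.wordSize ≤ C * n ^ k

end Protocol

/-- `G` is a cycle on all of its `n` vertices. -/
def IsOneCycle {n : ℕ} (G : SimpleGraph (Fin n)) : Prop :=
  Nonempty (G ≃g SimpleGraph.cycleGraph n)

/-- `G` consists of two vertex-disjoint cycles of length `k`. -/
def IsTwoCycles {k : ℕ} (G : SimpleGraph (Fin (2 * k))) : Prop :=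
  Nonempty (G ≃g (SimpleGraph.cycleGraph k ⊕g SimpleGraph.cycleGraph k))

open Classical in
/-- The protocols `A n` (for graphs with `n` vertices, given by their edges) distinguish one cycle
of length `n = 2 * k` from two cycles of length `k`, with high probability (error at most `n ^ (-a)`
for a constant `a > 0`), within `r n G` rounds on the graph `G`. -/
def DistinguishesCycles (A : ∀ n : ℕ, Protocol (Sym2 (Fin n)))
    (r : ∀ n : ℕ, SimpleGraph (Fin n) → ℕ) : Prop :=
  ∃ a : ℝ, 0 < a ∧ ∀ k : ℕ, 3 ≤ k → ∀ G : SimpleGraph (Fin (2 * k)),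
    IsOneCycle G ∨ IsTwoCycles G →
      (A (2 * k)).Decides G.edgeFinset (IsOneCycle G) (r (2 * k) G)
        (((2 * k : ℕ) : ℝ) ^ (-a))

/-- The 1-vs-2-cycle conjecture: for every constant `0 < δ < 1`, distinguishing one cycle of length
`n` from two cycles of length `n / 2` requires `Ω(log n)` rounds with local memory `O(n ^ δ)` (and
polynomially many machines). -/
def OneVsTwoCycleConjecture : Prop :=
  ∀ δ : ℝ, 0 < δ → δ < 1 →
  ∀ (A : ∀ n : ℕ, Protocol (Sym2 (Fin n))) (r : ∀ n : ℕ, SimpleGraph (Fin n) → ℕ),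
    (∃ C k : ℕ, ∀ᶠ n in atTop, (A n).WithinResources δ C k n) →
    DistinguishesCycles A r →
    ∃ c : ℝ, 0 < c ∧ ∀ᶠ k : ℕ in atTop, ∃ G : SimpleGraph (Fin (2 * k)),
      (IsOneCycle G ∨ IsTwoCycles G) ∧
      c * Real.log ((2 * k : ℕ) : ℝ) ≤ (r (2 * k) G : ℝ)

section Forests

variable {V : Type}

/-- `F` is the edge set of a spanning forest of `G`: an acyclic set of edges of `G` that connects
any two vertices that are connected in `G`. -/
def IsSpanningForest (G : SimpleGraph V) (F : Finset (Sym2 V)) : Prop :=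
  (F : Set (Sym2 V)) ⊆ G.edgeSet ∧
  (SimpleGraph.fromEdgeSet (F : Set (Sym2 V))).IsAcyclic ∧
  ∀ u v : V, G.Reachable u v → (SimpleGraph.fromEdgeSet (F : Set (Sym2 V))).Reachable u v

/-- `F` is a spanning forest of `G` of minimum total weight. -/
def IsMinimumSpanningForest (G : SimpleGraph V) (w : Sym2 V → ℕ) (F : Finset (Sym2 V)) : Prop :=
  IsSpanningForest G F ∧
  ∀ F' : Finset (Sym2 V), IsSpanningForest G F' → ∑ e ∈ F, w e ≤ ∑ e ∈ F', w e

end Forests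

/-- An input of the verification problem: a graph on `n` vertices with edge weights at most `n ^ κ`
(weights that fit into `O(1)` words), and a set `T` of `n - 1` of its edges. -/
structure VerificationInput (κ n : ℕ) where
  G : SimpleGraph (Fin n)
  w : Sym2 (Fin n) → ℕ
  T : Finset (Sym2 (Fin n))
  weight_le : ∀ e ∈ G.edgeSet, w e ≤ n ^ κ
  subset : (T : Set (Sym2 (Fin n))) ⊆ G.edgeSet
  card_add_one : T.card + 1 = n

namespace VerificationInput

variable {κ n : ℕ} (I : VerificationInput κ n)

open Classical in
/-- The input as given to the machines: one record per edge of the graph, with its weight and with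
a bit that tells whether the edge is in `T`. -/
noncomputable def records : Finset (Sym2 (Fin n) × ℕ × Bool) :=
  I.G.edgeFinset.image (fun e => (e, I.w e, decide (e ∈ I.T)))

/-- The diameter of `T`: the largest distance in `T` between two vertices of the same component
of `T`. (The distance `SimpleGraph.dist` is `0` for vertices of different components, so these do
not contribute.) -/
noncomputable def diamT : ℕ :=
  Finset.univ.sup fun p : Fin n × Fin n =>
    (SimpleGraph.fromEdgeSet (I.T : Set (Sym2 (Fin n)))).dist p.1 p.2

end VerificationInput

/-- The protocols `A n m` (for graphs with `n` vertices and `m` edges) decide whether `T` is a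
minimum spanning forest of `G`, with high probability (error at most `n ^ (-a)` for a constant
`a > 0`), within `r n I` rounds on the input `I`. -/
def VerifiesMSF (κ : ℕ) (A : ∀ n _m : ℕ, Protocol (Sym2 (Fin n) × ℕ × Bool))
    (r : ∀ n : ℕ, VerificationInput κ n → ℕ) : Prop :=
  ∃ a : ℝ, 0 < a ∧ ∀ (n : ℕ) (I : VerificationInput κ n),
    (A n I.records.card).Decides I.records (IsMinimumSpanningForest I.G I.w I.T) (r n I)
      ((n : ℝ) ^ (-a))

/-! The proof turns an MSF verifier into a protocol for the cycle problem without any communication.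
Let `G` be one cycle or two equal cycles on `N + 2` vertices. Deleting the last vertex leaves `N`
edges on `N + 1` vertices, the right number for `T`. If `G` is one cycle, these edges form a
Hamiltonian path. If `G` is two cycles, the cycle that avoids the deleted vertex survives and `T` is
not a forest. Tree edges get weight `0`, so `T` is a minimum spanning forest exactly when it is
acyclic, that is, when `G` is one cycle (`cycles_delete_last`,
`isMinimumSpanningForest_redirectInput`). In both cases `T` contains a path whose length is linear
in `N`, so `log D_T` and `log n` agree up to a constant.

The two edges at the deleted vertex are not dropped: the verifier is only known to have room for as
many records as its own input has, so the reduction keeps the number of records. They become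
non-tree edges at a vertex `x`. A machine sees only its own edges and cannot choose `x` so that the
result is a simple graph, so `x` is drawn from the common random string. At most four choices are
bad (`exists_good_targets`), which costs a factor `1 - 4 / (N + 1)` in the success probability
(`Protocol.Decides.precompose`). The error stays polynomially small (`exists_rpow_error`), so the
conjecture applies. -/

namespace SimpleGraph

/-! ### Component embeddings and distance bounds -/

/-- `φ` embeds `G` into `G'` as a union of connected components. -/
def IsComponentEmbedding {V W : Type} (G : SimpleGraph V) (G' : SimpleGraph W) (φ : V → W) : Prop :=
  Function.Injective φ ∧ ∀ i w, G'.Adj (φ i) w ↔ ∃ j, w = φ j ∧ G.Adj i j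

section

variable {V W : Type} {G : SimpleGraph V} {G' : SimpleGraph W}

theorem Iso.isComponentEmbedding (e : G ≃g G') : IsComponentEmbedding G G' e := by
  refine ⟨e.injective, fun i w => ?_⟩
  obtain ⟨j, rfl⟩ := e.surjective w
  simp [Iso.map_adj_iff]

theorem isComponentEmbedding_inl (G : SimpleGraph V) (G' : SimpleGraph W) :
    IsComponentEmbedding G (G ⊕g G') Sum.inl := by
  refine ⟨Sum.inl_injective, fun i w => ?_⟩
  cases w <;> simp

theorem isComponentEmbedding_inr (G : SimpleGraph V) (G' : SimpleGraph W) :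
    IsComponentEmbedding G' (G ⊕g G') Sum.inr := by
  refine ⟨Sum.inr_injective, fun i w => ?_⟩
  cases w <;> simp

theorem IsComponentEmbedding.iso_comp {U : Type} {G'' : SimpleGraph U} {φ : V → W}
    (h : IsComponentEmbedding G G' φ) (e : G' ≃g G'') : IsComponentEmbedding G G'' (e ∘ φ) := by
  refine ⟨e.injective.comp h.1, fun i w => ?_⟩
  obtain ⟨w, rfl⟩ := e.surjective w
  simp [Iso.map_adj_iff, h.2]

theorem IsComponentEmbedding.neighborSet_eq {φ : V → W} (h : IsComponentEmbedding G G' φ) (i : V) :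
    G'.neighborSet (φ i) = φ '' G.neighborSet i := by
  ext w
  simp only [mem_neighborSet, h.2, Set.mem_image]
  constructor
  · rintro ⟨j, rfl, hj⟩; exact ⟨j, hj, rfl⟩
  · rintro ⟨j, hj, rfl⟩; exact ⟨j, rfl, hj⟩

theorem ncard_neighborSet_cycleGraph {m : ℕ} (i : Fin (m + 3)) :
    ((cycleGraph (m + 3)).neighborSet i).ncard = 2 := by
  rw [Set.ncard_eq_toFinset_card']
  exact cycleGraph_degree_three_le

theorem IsComponentEmbedding.ncard_neighborSet {m : ℕ} {φ : Fin (m + 3) → W}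
    (h : IsComponentEmbedding (cycleGraph (m + 3)) G' φ) (i : Fin (m + 3)) :
    (G'.neighborSet (φ i)).ncard = 2 := by
  rw [h.neighborSet_eq, Set.ncard_image_of_injective _ h.1, ncard_neighborSet_cycleGraph]

/-- An integer potential that grows by at most one along each edge grows by at most the length of a
walk. This bounds distances from below without describing shortest paths. -/
theorem sub_le_dist_of_adj {f : V → ℤ} (hf : ∀ a b, G.Adj a b → f b ≤ f a + 1) {u v : V}
    (h : G.Reachable u v) : f v - f u ≤ G.dist u v := by
  have key : ∀ {a b : V} (p : G.Walk a b), f b - f a ≤ p.length := by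
    intro a b p
    induction p with
    | nil => simp
    | cons hadj p ih =>
      have := hf _ _ hadj
      rw [Walk.length_cons]
      push_cast
      linarith
  obtain ⟨p, hp⟩ := h.exists_walk_length_eq_dist
  rw [← hp]
  exact key p

theorem Reachable.dist_lt_card [Fintype V] {u v : V} (h : G.Reachable u v) :
    G.dist u v < Fintype.card V := by
  obtain ⟨p, hp, hl⟩ := h.exists_path_of_dist
  rw [← hl]
  exact hp.length_lt

theorem reachable_of_adj_succ {p : ℕ → V} {m : ℕ} (h : ∀ t < m, G.Adj (p t) (p (t + 1))) :
    ∀ t ≤ m, G.Reachable (p 0) (p t) := by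
  intro t
  induction t with
  | zero => intro _; rfl
  | succ t ih => intro ht; exact (ih (by omega)).trans (h t ht).reachable

end

theorem cycleGraph_adj_add_one {m : ℕ} (i : Fin (m + 2)) : (cycleGraph (m + 2)).Adj i (i + 1) := by
  rw [cycleGraph_adj]; right; simp

/-! ### Deleting the last vertex from a union of cycles -/

section DeleteVertex

open scoped Fin.CommRing Fin.NatCast

variable {N : ℕ} {G : SimpleGraph (Fin (N + 2))}

/-- Deleting a vertex from a cycle component leaves a path. -/
theorem IsComponentEmbedding.exists_path_comap_castSucc {m : ℕ} {φ : Fin (m + 2) → Fin (N + 2)}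
    (h : IsComponentEmbedding (cycleGraph (m + 2)) G φ) {j : Fin (m + 2)}
    (hj : φ j = Fin.last (N + 1)) :
    ∃ p : ℕ → Fin (N + 1), (∀ t ≤ m, (p t).castSucc = φ (j + 1 + t)) ∧
      ∀ t < m, (G.comap Fin.castSucc).Adj (p t) (p (t + 1)) := by
  have hne : ∀ t ≤ m, ∃ q : Fin (N + 1), q.castSucc = φ (j + 1 + t) := by
    intro t ht
    refine Fin.exists_castSucc_eq.2 fun hl => ?_
    -- Returning to the deleted vertex `j` would need `m + 2 ∣ 1 + t`, impossible for `t ≤ m`.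
    have h0 : (1 + t : Fin (m + 2)) = 0 := by
      have := h.1 (hl.trans hj.symm)
      rwa [add_assoc, add_eq_left] at this
    have h1 : ((1 + t : ℕ) : Fin (m + 2)) = 0 := by push_cast; exact h0
    rw [Fin.natCast_eq_zero] at h1
    have := Nat.le_of_dvd (by omega) h1
    omega
  choose! p hp using hne
  refine ⟨p, hp, fun t ht => ?_⟩
  rw [comap_adj, hp t ht.le, hp (t + 1) ht, h.2]
  refine ⟨_, rfl, ?_⟩
  have := cycleGraph_adj_add_one (j + 1 + (t : Fin (m + 2)))
  push_cast
  rwa [add_assoc (j + 1)] at this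

theorem IsComponentEmbedding.exists_le_dist_comap_castSucc {m : ℕ}
    {φ : Fin (m + 2) → Fin (N + 2)}
    (h : IsComponentEmbedding (cycleGraph (m + 2)) G φ) {j : Fin (m + 2)}
    (hj : φ j = Fin.last (N + 1)) :
    ∃ u v, m ≤ (G.comap Fin.castSucc).dist u v := by
  obtain ⟨p, hp, hadj⟩ := h.exists_path_comap_castSucc hj
  refine ⟨p 0, p m, ?_⟩
  have hr := reachable_of_adj_succ hadj m le_rfl
  -- The potential is the position on the remaining path, counted from the successor of `j`; it is
  -- `0` on the other components, which no edge joins to this one.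
  let f : Fin (N + 2) → ℤ := Function.extend φ (fun i => ((i - (j + 1)).val : ℤ)) 0
  have hfφ : ∀ i, f (φ i) = ((i - (j + 1)).val : ℤ) := h.1.extend_apply _ _
  have hf : ∀ a b, (G.comap Fin.castSucc).Adj a b → f b.castSucc ≤ f a.castSucc + 1 := by
    intro a b hab
    rw [comap_adj] at hab
    by_cases ha : ∃ i, φ i = a.castSucc
    · obtain ⟨i, hi⟩ := ha
      rw [← hi, h.2] at hab
      obtain ⟨i', hi', hii'⟩ := hab
      rw [← hi, hi', hfφ, hfφ]
      rw [cycleGraph_adj] at hii'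
      have hne : i ≠ j := by
        rintro rfl
        exact Fin.castSucc_ne_last a (hi.symm.trans hj)
      -- Position `m + 1` belongs to `j` itself, so `+ 1` never wraps around on the surviving
      -- vertices.
      have hne' : i - (j + 1) ≠ Fin.last (m + 1) := by
        intro hlast
        apply hne
        have h2 : i - (j + 1) + 1 = 0 := by rw [hlast, Fin.last_add_one]
        have h3 : i - j = 0 := by rw [← h2]; abel
        exact sub_eq_zero.1 h3
      rcases hii' with h1 | h1
      · have h2 : i - (j + 1) = i' - (j + 1) + 1 := by
          rw [← h1]; abel
        by_cases h3 : i' - (j + 1) = Fin.last (m + 1)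
        · exfalso
          have : i' = j := by
            have h2 : i' - (j + 1) + 1 = 0 := by rw [h3, Fin.last_add_one]
            have h3 : i' - j = 0 := by rw [← h2]; abel
            exact sub_eq_zero.1 h3
          subst this
          exact Fin.castSucc_ne_last b (hi'.trans hj)
        · rw [h2, Fin.val_add_one_of_lt (Fin.lt_last_iff_ne_last.2 h3)]
          push_cast
          linarith
      · have h2 : i' - (j + 1) = i - (j + 1) + 1 := by
          rw [← h1]; abel
        rw [h2, Fin.val_add_one_of_lt (Fin.lt_last_iff_ne_last.2 hne')]
        push_cast
        exact le_rfl
    · have hb : ¬ ∃ i, φ i = b.castSucc := by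
        rintro ⟨i, hi⟩
        have := hab.symm
        rw [← hi, h.2] at this
        obtain ⟨i', hi', -⟩ := this
        exact ha ⟨i', hi'.symm⟩
      have e1 : f a.castSucc = 0 := Function.extend_apply' _ _ _ ha
      have e2 : f b.castSucc = 0 := Function.extend_apply' _ _ _ hb
      rw [e1, e2]; norm_num
  have hd := sub_le_dist_of_adj (f := fun a : Fin (N + 1) => f a.castSucc) hf hr
  simp only [hp 0 (Nat.zero_le _), hp m le_rfl, hfφ] at hd
  have e0 : ((j + 1 + ((0 : ℕ) : Fin (m + 2)) - (j + 1)).val : ℤ) = 0 := by simp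
  have e1 : ((j + 1 + ((m : ℕ) : Fin (m + 2)) - (j + 1)).val : ℤ) = m := by
    rw [add_sub_cancel_left, Fin.val_natCast, Nat.mod_eq_of_lt (by omega)]
  rw [e0, e1] at hd
  exact_mod_cast (by simpa using hd)

theorem Iso.connected_comap_castSucc (e : cycleGraph (N + 2) ≃g G) :
    (G.comap Fin.castSucc).Connected := by
  obtain ⟨j, hj⟩ := e.surjective (Fin.last (N + 1))
  obtain ⟨p, hp, hadj⟩ := e.isComponentEmbedding.exists_path_comap_castSucc hj
  have hr := reachable_of_adj_succ hadj
  have hall : ∀ a, (G.comap Fin.castSucc).Reachable (p 0) a := by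
    intro a
    obtain ⟨i, hi⟩ := e.surjective a.castSucc
    have hcast : j + 1 + ((i - (j + 1)).val : Fin (N + 2)) = i := by
      rw [Fin.cast_val_eq_self]; abel
    have hle : (i - (j + 1)).val ≤ N := by
      by_contra hlt
      have h3 : i - (j + 1) = Fin.last (N + 1) := by
        ext
        have := (i - (j + 1)).isLt
        rw [Fin.val_last]
        omega
      have : i = j := by
        have h2 : i - (j + 1) + 1 = 0 := by rw [h3, Fin.last_add_one]
        have h3 : i - j = 0 := by rw [← h2]; abel
        exact sub_eq_zero.1 h3
      subst this
      exact Fin.castSucc_ne_last a (hi.symm.trans hj)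
    have := hp _ hle
    rw [hcast, hi] at this
    rw [← Fin.castSucc_injective _ this]
    exact hr _ hle
  exact ⟨fun a b => (hall a).symm.trans (hall b)⟩

/-- A cycle component that misses the deleted vertex survives unchanged. This is what betrays the
two-cycle case. -/
theorem IsComponentEmbedding.not_isAcyclic_comap_castSucc {m : ℕ} {φ : Fin (m + 3) → Fin (N + 2)}
    (h : IsComponentEmbedding (cycleGraph (m + 3)) G φ) (hlast : ∀ j, φ j ≠ Fin.last (N + 1)) :
    ¬ (G.comap Fin.castSucc).IsAcyclic := by
  intro hac
  choose ψ hψ using fun j => Fin.exists_castSucc_eq.2 (hlast j)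
  have hinj : Function.Injective ψ := fun a b hab => h.1 (by rw [← hψ, ← hψ, hab])
  let f : cycleGraph (m + 3) →g G.comap Fin.castSucc :=
    ⟨ψ, fun {a b} hab => by
      rw [comap_adj, hψ, hψ, h.2]; exact ⟨b, rfl, hab⟩⟩
  exact hac.comap f hinj _ cycleGraph.isCycle_cycle

open Classical in
-- By the handshake identity a `2`-regular graph has as many edges as vertices; the deleted vertex
-- takes two of them along.
theorem card_edgeFinset_comap_castSucc (h : ∀ v, (G.neighborSet v).ncard = 2) :
    (G.comap Fin.castSucc).edgeFinset.card = N ∧ G.edgeFinset.card = N + 2 := by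
  have hdeg : ∀ v, G.degree v = 2 := fun v => by
    have := h v
    rwa [Set.ncard_eq_toFinset_card'] at this
  have h2 : G.edgeFinset.card = N + 2 := by
    have := G.sum_degrees_eq_twice_card_edges
    simp only [hdeg, Finset.sum_const, Finset.card_univ, Fintype.card_fin, smul_eq_mul] at this
    omega
  refine ⟨?_, h2⟩
  have h1 := card_edgeFinset_induce_compl_singleton G (Fin.last (N + 1))
  rw [card_edgeFinset_deleteIncidenceSet, h2, hdeg] at h1
  let e : G.comap Fin.castSucc ≃g G.induce {Fin.last (N + 1)}ᶜ :=
    ⟨Equiv.ofBijective (fun a => ⟨a.castSucc, by simp⟩)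
      ⟨fun a b hab => Fin.castSucc_injective _ (congrArg Subtype.val hab), fun ⟨b, hb⟩ => by
        obtain ⟨a, ha⟩ := Fin.exists_castSucc_eq.2 (by simpa using hb)
        exact ⟨a, Subtype.ext ha⟩⟩, Iff.rfl⟩
  have h3 := e.card_edgeFinset_eq
  omega

end DeleteVertex

end SimpleGraph

open SimpleGraph

/-- What the reduction uses about a cycle or a pair of cycles on the vertices `0, …, N + 1`:
the graph is `2`-regular, and deleting the last vertex leaves a graph of large diameter that is a
tree if and only if the graph is one cycle. -/
theorem cycles_delete_last {N k : ℕ} (hk : 3 ≤ k) (hN : 2 * k = N + 2)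
    (G : SimpleGraph (Fin (N + 2)))
    (hG : IsOneCycle G ∨ Nonempty (G ≃g (cycleGraph k ⊕g cycleGraph k))) :
    (∀ v, (G.neighborSet v).ncard = 2) ∧
    (∃ u v, k - 2 ≤ (G.comap Fin.castSucc).dist u v) ∧
    ((G.comap Fin.castSucc).IsAcyclic ↔ IsOneCycle G) ∧
    (IsOneCycle G → (G.comap Fin.castSucc).Connected) := by
  obtain ⟨k, rfl⟩ := Nat.exists_eq_add_of_le' hk
  have hconn : IsOneCycle G → (G.comap Fin.castSucc).Connected :=
    fun ⟨e⟩ => Iso.connected_comap_castSucc e.symm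
  have hreg : ∀ v, (G.neighborSet v).ncard = 2 := by
    intro v
    rcases hG with ⟨⟨e⟩⟩ | ⟨⟨e⟩⟩
    · obtain ⟨N, rfl⟩ : ∃ M, N = M + 1 := ⟨N - 1, by omega⟩
      obtain ⟨i, rfl⟩ := e.symm.surjective v
      exact e.symm.isComponentEmbedding.ncard_neighborSet i
    · obtain ⟨i | i, rfl⟩ := e.symm.surjective v
      · exact ((isComponentEmbedding_inl _ _).iso_comp e.symm).ncard_neighborSet i
      · exact ((isComponentEmbedding_inr _ _).iso_comp e.symm).ncard_neighborSet i
  have hac : IsOneCycle G → (G.comap Fin.castSucc).IsAcyclic := by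
    classical
    intro h
    have h1 := (card_edgeFinset_comap_castSucc hreg).1
    refine (isTree_iff_connected_and_card.2 ⟨hconn h, ?_⟩).isAcyclic
    rw [Nat.card_eq_fintype_card, ← edgeFinset_card, h1, Nat.card_eq_fintype_card,
      Fintype.card_fin]
  refine ⟨hreg, ?_, ⟨fun h => ?_, hac⟩, hconn⟩
  · rcases hG with ⟨⟨e⟩⟩ | ⟨⟨e⟩⟩
    · obtain ⟨j, hj⟩ := e.symm.surjective (Fin.last (N + 1))
      obtain ⟨u, v, h⟩ := e.symm.isComponentEmbedding.exists_le_dist_comap_castSucc hj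
      exact ⟨u, v, le_trans (by omega) h⟩
    · obtain ⟨j | j, hj⟩ := e.symm.surjective (Fin.last (N + 1))
      · exact ((isComponentEmbedding_inl _ _).iso_comp
          e.symm).exists_le_dist_comap_castSucc (m := k + 1) hj
      · exact ((isComponentEmbedding_inr _ _).iso_comp
          e.symm).exists_le_dist_comap_castSucc (m := k + 1) hj
  · rcases hG with hG | ⟨⟨e⟩⟩
    · exact hG
    · exfalso
      obtain ⟨j | j, hj⟩ := e.symm.surjective (Fin.last (N + 1))
      · refine ((isComponentEmbedding_inr _ _).iso_comp
          e.symm).not_isAcyclic_comap_castSucc (fun i hi => ?_) h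
        exact Sum.inr_ne_inl (e.symm.injective (hi.trans hj.symm))
      · refine ((isComponentEmbedding_inl _ _).iso_comp
          e.symm).not_isAcyclic_comap_castSucc (fun i hi => ?_) h
        exact Sum.inl_ne_inr (e.symm.injective (hi.trans hj.symm))

/-! ### Local reductions with public randomness -/

namespace Protocol

variable {ρ σ : Type}

/-- The protocol `P` run on the image of the input under a map on the local shares that depends on
additional public randomness. -/
def precompose (P : Protocol ρ) (s : ℕ) (hs : 0 < s) (g : Fin s → Finset σ → Finset ρ) :
    Protocol σ where
  machines := P.machines
  memory := P.memory
  wordSize := P.wordSize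
  load := P.load
  load_le_memory := P.load_le_memory
  seeds := s * P.seeds
  seeds_pos := Nat.mul_pos hs P.seeds_pos
  init ω i X := P.init (finProdFinEquiv.symm ω).2 i (g (finProdFinEquiv.symm ω).1 X)
  send ω := P.send (finProdFinEquiv.symm ω).2
  next ω := P.next (finProdFinEquiv.symm ω).2
  root := P.root
  answer ω := P.answer (finProdFinEquiv.symm ω).2

theorem config_precompose (P : Protocol ρ) {s : ℕ} (hs : 0 < s) (g : Fin s → Finset σ → Finset ρ)
    (x : Fin s) (ω : Fin P.seeds) (X : Fin P.machines → Finset σ) (t : ℕ) :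
    (P.precompose s hs g).config (finProdFinEquiv (x, ω)) X t =
      P.config ω (fun i => g x (X i)) t := by
  induction t with
  | zero =>
    funext i
    change P.init _ _ _ = P.init _ _ _
    simp
  | succ t ih =>
    funext i
    change P.next (finProdFinEquiv.symm (finProdFinEquiv (x, ω))).2 t i
      ((P.precompose s hs g).config (finProdFinEquiv (x, ω)) X t i)
      (P.inbox (finProdFinEquiv.symm (finProdFinEquiv (x, ω))).2 t
        ((P.precompose s hs g).config (finProdFinEquiv (x, ω)) X t) i) = _
    rw [ih, Equiv.symm_apply_apply]
    rfl

theorem answersWithin_precompose (P : Protocol ρ) {s : ℕ} (hs : 0 < s)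
    (g : Fin s → Finset σ → Finset ρ) (x : Fin s) (ω : Fin P.seeds)
    (X : Fin P.machines → Finset σ) (r : ℕ) (b : Bool) :
    (P.precompose s hs g).AnswersWithin (finProdFinEquiv (x, ω)) X r b ↔
      P.AnswersWithin ω (fun i => g x (X i)) r b := by
  have hbw : ∀ t, (P.precompose s hs g).RespectsBandwidth (finProdFinEquiv (x, ω)) X t ↔
      P.RespectsBandwidth ω (fun i => g x (X i)) t := by
    intro t
    change (∀ i, (P.send (finProdFinEquiv.symm (finProdFinEquiv (x, ω))).2 t i
      ((P.precompose s hs g).config (finProdFinEquiv (x, ω)) X t i)).length ≤ P.memory ∧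
      ∑ j, (P.inbox (finProdFinEquiv.symm (finProdFinEquiv (x, ω))).2 t
        ((P.precompose s hs g).config (finProdFinEquiv (x, ω)) X t) i j).length ≤ P.memory) ↔ _
    rw [config_precompose, Equiv.symm_apply_apply]
    rfl
  have hans : ∀ t, (P.precompose s hs g).answer (finProdFinEquiv (x, ω)) t
      ((P.precompose s hs g).config (finProdFinEquiv (x, ω)) X t (P.precompose s hs g).root) =
      P.answer ω t (P.config ω (fun i => g x (X i)) t P.root) := by
    intro t
    change P.answer (finProdFinEquiv.symm (finProdFinEquiv (x, ω))).2 t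
      ((P.precompose s hs g).config (finProdFinEquiv (x, ω)) X t P.root) = _
    rw [config_precompose, Equiv.symm_apply_apply]
  unfold AnswersWithin
  simp only [hbw, hans]

theorem AnswersWithin.mono {P : Protocol ρ} {ω : Fin P.seeds} {X : Fin P.machines → Finset ρ}
    {r r' : ℕ} {b : Bool} (h : P.AnswersWithin ω X r b) (hr : r ≤ r') :
    P.AnswersWithin ω X r' b := by
  obtain ⟨t, ht, h⟩ := h
  exact ⟨t, ht.trans hr, h⟩

open Classical in
/-- If the protocol `P` succeeds on the images of the input `X` under the record maps `h x`, for
all but `b` values of the public randomness `x`, then `P` precomposed with these maps succeeds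
on `X`. -/
theorem Decides.precompose [DecidableEq ρ] {P : Protocol ρ} {s b : ℕ} (hs : 0 < s) (h : Fin s → σ → ρ)
    {X : Finset σ} {Q : Prop} {r : ℕ} {ε ε' : ℝ} (good : Finset (Fin s))
    (hb : s ≤ good.card + b) (hbs : b < s) (hε : ε ≤ 1)
    (hinj : ∀ x ∈ good, Set.InjOn (h x) X)
    (hdec : ∀ x ∈ good, P.Decides (X.image (h x)) Q r ε)
    (hε' : 1 - ε' ≤ (1 - b / s) * (1 - ε)) :
    (P.precompose s hs (fun x Y => Y.image (h x))).Decides X Q r ε' := by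
  constructor
  -- Injectivity preserves the number of records, so the capacity bound of `P` carries over.
  · obtain ⟨x, hx⟩ : good.Nonempty := Finset.card_pos.1 (by omega)
    have := (hdec x hx).1
    rwa [Finset.card_image_of_injOn (hinj x hx)] at this
  rintro (f : σ → Fin P.machines) hf
  change ∀ i : Fin P.machines, _ ≤ P.load at hf
  refine hε'.trans ?_
  set W := Finset.univ.filter (fun ω : Fin (s * P.seeds) =>
    (P.precompose s hs (fun x Y => Y.image (h x))).AnswersWithin ω
      ((P.precompose s hs (fun x Y => Y.image (h x))).share X f) r (decide Q)) with hW
  have hslice : ∀ x ∈ good, (1 - ε) * P.seeds ≤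
      ((Finset.univ.filter (fun ω : Fin P.seeds => finProdFinEquiv (x, ω) ∈ W)).card : ℝ) := by
    intro x hx
    have hpos : 0 < (P.seeds : ℝ) := by exact_mod_cast P.seeds_pos
    obtain ⟨-, hd⟩ := hdec x hx
    -- Each image record is placed where its unique preimage lies, so that mapping the local shares
    -- realises a distribution of the image. The value `P.root` off the image is irrelevant.
    let f' : ρ → Fin P.machines := fun e =>
      if he : ∃ a ∈ X, h x a = e then f he.choose else P.root
    have hf' : ∀ a ∈ X, f' (h x a) = f a := by
      intro a ha
      have he : ∃ a' ∈ X, h x a' = h x a := ⟨a, ha, rfl⟩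
      have : he.choose = a := hinj x hx he.choose_spec.1 ha he.choose_spec.2
      change (if he : ∃ a' ∈ X, h x a' = h x a then f he.choose else P.root) = f a
      rw [dif_pos he, this]
    have hshare : ∀ i, P.share (X.image (h x)) f' i =
        ((P.precompose s hs (fun x Y => Y.image (h x))).share X f i).image (h x) := by
      intro i
      ext e
      simp only [share, Finset.mem_filter, Finset.mem_image]
      constructor
      · rintro ⟨⟨a, ha, rfl⟩, hi⟩
        exact ⟨a, ⟨ha, by rw [← hf' a ha]; exact hi⟩, rfl⟩
      · rintro ⟨a, ⟨ha, hi⟩, rfl⟩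
        exact ⟨⟨a, ha, rfl⟩, by rw [hf' a ha]; exact hi⟩
    have h1 := hd f' fun i => by
      rw [hshare i]
      exact Finset.card_image_le.trans (hf i)
    rw [le_div_iff₀ hpos] at h1
    refine h1.trans_eq ?_
    congr 2
    ext ω
    simp only [hW, Finset.mem_filter, Finset.mem_univ, true_and]
    rw [funext hshare]
    exact (answersWithin_precompose P hs (fun x Y => Y.image (h x)) x ω
      ((P.precompose s hs (fun x Y => Y.image (h x))).share X f) r _).symm
  -- Slices of the seed space over different `x` are disjoint.
  have hsum : ∑ x ∈ good, (Finset.univ.filter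
      (fun ω : Fin P.seeds => finProdFinEquiv (x, ω) ∈ W)).card ≤ W.card := by
    rw [← Finset.card_sigma]
    refine Finset.card_le_card_of_injOn (fun p => finProdFinEquiv (p.1, p.2)) ?_ ?_
    · rintro ⟨x, ω⟩ hp
      simp only [Finset.coe_sigma, Set.mem_sigma_iff, Finset.mem_coe, Finset.mem_filter,
        Finset.mem_univ, true_and] at hp
      exact hp.2
    · rintro ⟨x, ω⟩ _ ⟨x', ω'⟩ _ hp
      have := finProdFinEquiv.injective hp
      simp only [Prod.mk.injEq] at this
      obtain ⟨rfl, rfl⟩ := this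
      rfl
  have hs' : (0 : ℝ) < s := by exact_mod_cast hs
  have hpos : (0 : ℝ) < P.seeds := by exact_mod_cast P.seeds_pos
  have hseeds : ((P.precompose s hs (fun x Y => Y.image (h x))).seeds : ℝ) = s * P.seeds := by
    change ((s * P.seeds : ℕ) : ℝ) = _
    push_cast; rfl
  rw [hseeds, le_div_iff₀ (by positivity)]
  calc (1 - (b : ℝ) / s) * (1 - ε) * (s * P.seeds)
      = (s - b) * ((1 - ε) * P.seeds) := by field_simp
    _ ≤ good.card * ((1 - ε) * P.seeds) := by
        refine mul_le_mul_of_nonneg_right ?_ (mul_nonneg (by linarith) hpos.le)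
        have : (s : ℝ) ≤ good.card + b := by exact_mod_cast hb
        linarith
    _ = ∑ _x ∈ good, (1 - ε) * P.seeds := by rw [Finset.sum_const, nsmul_eq_mul]
    _ ≤ ∑ x ∈ good, ((Finset.univ.filter
          (fun ω : Fin P.seeds => finProdFinEquiv (x, ω) ∈ W)).card : ℝ) :=
        Finset.sum_le_sum hslice
    _ ≤ W.card := by exact_mod_cast hsum

theorem Decides.mono_rounds {P : Protocol ρ} {X : Finset ρ} {Q : Prop} {r r' : ℕ} {ε : ℝ}
    (h : P.Decides X Q r ε) (hr : r ≤ r') : P.Decides X Q r' ε := by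
  refine ⟨h.1, fun f hf => (h.2 f hf).trans ?_⟩
  gcongr
  exact fun hω => hω.mono hr

end Protocol

/-! ### The verification instance built from a cycle graph -/

section Reduction

variable {N : ℕ}

/-- The vertex map that redirects the last vertex to `x`. -/
def redirectLast (x : Fin (N + 1)) : Fin (N + 2) → Fin (N + 1) :=
  Fin.lastCases x id

@[simp] theorem redirectLast_last (x : Fin (N + 1)) : redirectLast x (Fin.last (N + 1)) = x :=
  Fin.lastCases_last

@[simp] theorem redirectLast_castSucc (x a : Fin (N + 1)) : redirectLast x a.castSucc = a :=
  Fin.lastCases_castSucc a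

open Classical in
/-- The record of an edge after the deletion of the last vertex: edges at this vertex become heavy
edges at `x` outside of the tree, the other edges become tree edges of weight `0`. -/
noncomputable def redirectRecord (x : Fin (N + 1)) (e : Sym2 (Fin (N + 2))) :
    Sym2 (Fin (N + 1)) × ℕ × Bool :=
  (e.map (redirectLast x), if Fin.last (N + 1) ∈ e then 1 else 0,
    decide (Fin.last (N + 1) ∉ e))

open Classical in
/-- The verification input obtained from `G` by deleting the last vertex and redirecting its edges
to `x`. -/
noncomputable def redirectInput (κ : ℕ) (G : SimpleGraph (Fin (N + 2)))
    (hG : (G.comap Fin.castSucc).edgeFinset.card = N) (x : Fin (N + 1)) :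
    VerificationInput κ (N + 1) where
  G := fromEdgeSet (Sym2.map (redirectLast x) '' G.edgeSet)
  w e := if e ∈ (G.comap Fin.castSucc).edgeFinset then 0 else 1
  T := (G.comap Fin.castSucc).edgeFinset
  weight_le e _ := by
    have : 1 ≤ (N + 1) ^ κ := Nat.one_le_pow _ _ (Nat.succ_pos _)
    split <;> omega
  subset e he := by
    induction e with
    | _ a b =>
      simp only [coe_edgeFinset, mem_edgeSet, comap_adj] at he
      rw [mem_edgeSet, fromEdgeSet_adj]
      refine ⟨⟨s(a.castSucc, b.castSucc), he, by simp⟩, ?_⟩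
      rintro rfl
      exact G.loopless.irrefl _ he
  card_add_one := by rw [hG]

/-- Redirecting the edges at the last vertex to `x` creates no loops and no multiple edges. -/
def IsGoodTarget (G : SimpleGraph (Fin (N + 2))) (x : Fin (N + 1)) : Prop :=
  ∀ u : Fin (N + 1), G.Adj (Fin.last (N + 1)) u.castSucc → u ≠ x ∧ ¬ G.Adj u.castSucc x.castSucc

variable {κ : ℕ} {G : SimpleGraph (Fin (N + 2))}

theorem edge_cases {e : Sym2 (Fin (N + 2))} (he : e ∈ G.edgeSet) :
    (∃ a b : Fin (N + 1), e = s(a.castSucc, b.castSucc) ∧ G.Adj a.castSucc b.castSucc) ∨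
    ∃ u : Fin (N + 1), e = s(Fin.last (N + 1), u.castSucc) ∧
      G.Adj (Fin.last (N + 1)) u.castSucc := by
  induction e with
  | _ a b =>
    rw [mem_edgeSet] at he
    induction a using Fin.lastCases with
    | last =>
      induction b using Fin.lastCases with
      | last => exact absurd he (G.loopless.irrefl _)
      | cast b => exact Or.inr ⟨b, rfl, he⟩
    | cast a =>
      induction b using Fin.lastCases with
      | last => exact Or.inr ⟨a, Sym2.eq_swap, he.symm⟩
      | cast b => exact Or.inl ⟨a, b, rfl, he⟩

/-- The tree bit separates the edges at the deleted vertex from the others, and redirection is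
injective within each class. This holds for bad targets as well. -/
theorem injOn_redirectRecord (x : Fin (N + 1)) :
    Set.InjOn (redirectRecord x) G.edgeSet := by
  intro e he e' he' h
  simp only [redirectRecord, Prod.mk.injEq, decide_eq_decide] at h
  obtain ⟨h1, -, h2⟩ := h
  rcases edge_cases he with ⟨a, b, rfl, hab⟩ | ⟨u, rfl, hu⟩ <;>
  rcases edge_cases he' with ⟨a', b', rfl, hab'⟩ | ⟨u', rfl, hu'⟩
  · simp only [Sym2.map_mk, redirectLast_castSucc] at h1
    have := congrArg (Sym2.map Fin.castSucc) h1
    simpa using this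
  · simp [(Fin.castSucc_ne_last _).symm] at h2
  · simp [(Fin.castSucc_ne_last _).symm] at h2
  · simp only [Sym2.map_mk, redirectLast_castSucc, redirectLast_last, Sym2.congr_right] at h1
    rw [h1]

open Classical in
-- Weights and bits in the instance refer to membership in `T`, a global notion. For a good target a
-- redirected edge is neither a loop nor a tree edge, so each record depends only on the original
-- edge and `x`, and a machine can compute it alone.
theorem IsGoodTarget.records_redirectInput {x : Fin (N + 1)} (hx : IsGoodTarget G x)
    (hG : (G.comap Fin.castSucc).edgeFinset.card = N) :
    (redirectInput κ G hG x).records = G.edgeFinset.image (redirectRecord x) := by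
  have key : ∀ e ∈ G.edgeSet, ¬ (e.map (redirectLast x)).IsDiag ∧
      (e.map (redirectLast x) ∈ (G.comap Fin.castSucc).edgeSet ↔ Fin.last (N + 1) ∉ e) := by
    intro e he
    rcases edge_cases he with ⟨a, b, rfl, hab⟩ | ⟨u, rfl, hu⟩
    · have : a ≠ b := by rintro rfl; exact G.loopless.irrefl _ hab
      simp [this, hab, (Fin.castSucc_ne_last _).symm]
    · obtain ⟨h1, h2⟩ := hx u hu
      have h3 : ¬ G.Adj x.castSucc u.castSucc := fun h => h2 h.symm
      simp [h1.symm, h3]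
  have hrec : ∀ e ∈ G.edgeSet, (e.map (redirectLast x),
      (redirectInput κ G hG x).w (e.map (redirectLast x)),
      decide (e.map (redirectLast x) ∈ (redirectInput κ G hG x).T)) = redirectRecord x e := by
    intro e he
    have h := (key e he).2
    simp only [redirectInput, redirectRecord, mem_edgeFinset, h]
    by_cases hl : Fin.last (N + 1) ∈ e <;> simp [hl]
  ext p
  simp only [VerificationInput.records, Finset.mem_image, mem_edgeFinset]
  constructor
  · rintro ⟨e', he', rfl⟩
    change e' ∈ (fromEdgeSet (Sym2.map (redirectLast x) '' G.edgeSet)).edgeSet at he'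
    rw [edgeSet_fromEdgeSet] at he'
    obtain ⟨⟨e, he, rfl⟩, -⟩ := he'
    exact ⟨e, he, (hrec e he).symm⟩
  · rintro ⟨e, he, rfl⟩
    refine ⟨e.map (redirectLast x), ?_, hrec e he⟩
    change _ ∈ (fromEdgeSet (Sym2.map (redirectLast x) '' G.edgeSet)).edgeSet
    rw [edgeSet_fromEdgeSet]
    exact ⟨⟨e, he, rfl⟩, (key e he).1⟩

open Classical in
theorem exists_good_targets (hreg : ∀ v, (G.neighborSet v).ncard = 2) :
    ∃ S : Finset (Fin (N + 1)), (∀ x ∈ S, IsGoodTarget G x) ∧ N + 1 ≤ S.card + 4 := by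
  obtain ⟨p, q, hpq, hne⟩ := Set.ncard_eq_two.1 (hreg (Fin.last (N + 1)))
  -- A target is bad only if it is a neighbour `v` of the last vertex or the other neighbour of such
  -- a `v`: two vertices for each of `p` and `q`.
  let B : Fin (N + 2) → Finset (Fin (N + 2)) := fun v =>
    insert v ((G.neighborSet v).toFinset.erase (Fin.last (N + 1)))
  have hB : ∀ v, G.Adj (Fin.last (N + 1)) v → (B v).card ≤ 2 := by
    intro v hv
    refine (Finset.card_insert_le _ _).trans ?_
    rw [Finset.card_erase_of_mem (by simpa using hv.symm), ← Set.ncard_eq_toFinset_card', hreg]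
  have hadj : ∀ v, G.Adj (Fin.last (N + 1)) v ↔ v = p ∨ v = q := by
    intro v
    have : v ∈ G.neighborSet (Fin.last (N + 1)) ↔ v ∈ ({p, q} : Set _) := by rw [hne]
    simpa using this
  refine ⟨Finset.univ.filter (fun x => x.castSucc ∉ B p ∪ B q), ?_, ?_⟩
  · intro x hx u hu
    simp only [Finset.mem_filter, Finset.mem_univ, true_and, Finset.mem_union, not_or] at hx
    have hxu : x.castSucc ∉ B u.castSucc := by
      rcases (hadj _).1 hu with h | h <;> rw [h]
      exacts [hx.1, hx.2]
    simp only [B, Finset.mem_insert, Finset.mem_erase, Set.mem_toFinset, mem_neighborSet,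
      not_or] at hxu
    exact ⟨fun h => hxu.1 (by rw [h]), fun h => hxu.2 ⟨Fin.castSucc_ne_last _, h⟩⟩
  · have h1 := Finset.card_filter_add_card_filter_not (s := (Finset.univ : Finset (Fin (N + 1))))
      (fun x => x.castSucc ∉ B p ∪ B q)
    rw [Finset.card_univ, Fintype.card_fin] at h1
    have h2 : (Finset.univ.filter
        (fun x : Fin (N + 1) => ¬ x.castSucc ∉ B p ∪ B q)).card ≤ 4 := by
      calc _ ≤ (B p ∪ B q).card :=
            Finset.card_le_card_of_injOn Fin.castSucc
              (fun x hx => by simpa [or_iff_not_imp_left] using hx) (Fin.castSucc_injective _).injOn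
        _ ≤ (B p).card + (B q).card := Finset.card_union_le _ _
        _ ≤ 4 := by
            have := hB p ((hadj p).2 (Or.inl rfl))
            have := hB q ((hadj q).2 (Or.inr rfl))
            omega
    omega

open Classical in
-- Minimality is automatic since `T` has total weight `0`, and spanning follows from connectedness;
-- only acyclicity is at stake.
theorem isMinimumSpanningForest_redirectInput {x : Fin (N + 1)}
    (hG : (G.comap Fin.castSucc).edgeFinset.card = N)
    (hconn : (G.comap Fin.castSucc).IsAcyclic → (G.comap Fin.castSucc).Connected) :
    IsMinimumSpanningForest (redirectInput κ G hG x).G (redirectInput κ G hG x).w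
      (redirectInput κ G hG x).T ↔ (G.comap Fin.castSucc).IsAcyclic := by
  have hT : fromEdgeSet ((redirectInput κ G hG x).T : Set (Sym2 (Fin (N + 1)))) =
      G.comap Fin.castSucc := by
    simp [redirectInput]
  constructor
  · intro h
    have := h.1.2.1
    rwa [hT] at this
  · intro h
    refine ⟨⟨(redirectInput κ G hG x).subset, by rwa [hT], fun u v _ => ?_⟩, fun F' _ => ?_⟩
    · rw [hT]
      exact (hconn h).preconnected u v
    · rw [Finset.sum_eq_zero]
      · exact Nat.zero_le _
      · intro e he
        exact if_pos he

open Classical in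
theorem le_diamT_redirectInput {x : Fin (N + 1)}
    (hG : (G.comap Fin.castSucc).edgeFinset.card = N) (u v : Fin (N + 1)) :
    (G.comap Fin.castSucc).dist u v ≤ (redirectInput κ G hG x).diamT := by
  have hT : fromEdgeSet ((redirectInput κ G hG x).T : Set (Sym2 (Fin (N + 1)))) =
      G.comap Fin.castSucc := by
    simp [redirectInput]
  rw [← hT]
  exact Finset.le_sup (f := fun p : Fin (N + 1) × Fin (N + 1) => (fromEdgeSet
    ((redirectInput κ G hG x).T : Set (Sym2 (Fin (N + 1))))).dist p.1 p.2) (Finset.mem_univ (u, v))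

end Reduction

theorem VerificationInput.diamT_le {κ n : ℕ} (I : VerificationInput κ n) : I.diamT ≤ n := by
  refine Finset.sup_le fun p _ => ?_
  by_cases h : (fromEdgeSet (I.T : Set (Sym2 (Fin n)))).Reachable p.1 p.2
  · simpa using h.dist_lt_card.le
  · rw [dist_eq_zero_of_not_reachable h]; exact Nat.zero_le _

/-! ### The error exponent -/

/-- A success probability of `(1 - 4 / (n - 1)) * (1 - (n - 1) ^ (-a))` is high probability. -/
theorem exists_rpow_error {a : ℝ} (ha : 0 < a) : ∃ a' : ℝ, 0 < a' ∧ ∀ N : ℕ, 4 ≤ N →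
    1 - (((N + 2 : ℕ) : ℝ)) ^ (-a') ≤
      (1 - ((4 : ℕ) : ℝ) / ((N + 1 : ℕ) : ℝ)) * (1 - ((N + 1 : ℕ) : ℝ) ^ (-a)) := by
  set q : ℕ → ℝ := fun N =>
    (1 - ((4 : ℕ) : ℝ) / ((N + 1 : ℕ) : ℝ)) * (1 - ((N + 1 : ℕ) : ℝ) ^ (-a)) with hq
  have hqpos : ∀ N, 4 ≤ N → 0 < q N := by
    intro N hN
    have hN' : (4 : ℝ) ≤ N := by exact_mod_cast hN
    refine mul_pos ?_ ?_
    · rw [sub_pos, div_lt_one (by positivity)]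
      push_cast; linarith
    · rw [sub_pos]
      exact Real.rpow_lt_one_of_one_lt_of_neg (by push_cast; linarith) (by linarith)
  -- With `b < 1` and `b < a`, both error terms `4 / y` and `y ^ (-a)` are `o(y ^ (-b))`, which
  -- settles all large `N`.
  set b : ℝ := min a 1 / 2 with hb
  have hb0 : 0 < b := by positivity
  have hba : b < a := by
    have := min_le_left a 1
    have : 0 < min a 1 := by positivity
    linarith
  have hb1 : b < 1 := by
    have := min_le_right a 1
    have : 0 < min a 1 := by positivity
    linarith
  have hlarge : ∀ᶠ N : ℕ in atTop, 1 - (((N + 2 : ℕ) : ℝ)) ^ (-b) ≤ q N := by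
    have hcast : Tendsto (fun N : ℕ => ((N + 1 : ℕ) : ℝ)) atTop atTop :=
      tendsto_natCast_atTop_atTop.comp (tendsto_add_atTop_nat 1)
    have t1 : Tendsto (fun N : ℕ => 4 * 2 ^ b * ((N + 1 : ℕ) : ℝ) ^ (-(1 - b))
        + 2 ^ b * ((N + 1 : ℕ) : ℝ) ^ (-(a - b))) atTop (nhds (4 * 2 ^ b * 0 + 2 ^ b * 0)) :=
      (((tendsto_rpow_neg_atTop (by linarith)).comp hcast).const_mul _).add
        (((tendsto_rpow_neg_atTop (by linarith)).comp hcast).const_mul _)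
    have t2 := t1.eventually_lt_const (u := 1) (by simp)
    filter_upwards [t2] with N hN
    have hy : (0 : ℝ) < ((N + 1 : ℕ) : ℝ) := by positivity
    set y : ℝ := ((N + 1 : ℕ) : ℝ) with hydef
    have hy2 : (((N + 2 : ℕ) : ℝ)) ≤ 2 * y := by rw [hydef]; push_cast; linarith
    have e1 : (2 * y) ^ (-b) ≤ (((N + 2 : ℕ) : ℝ)) ^ (-b) :=
      Real.rpow_le_rpow_of_nonpos (by positivity) hy2 (by linarith)
    have e2 : 4 / y + y ^ (-a) ≤ (2 * y) ^ (-b) := by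
      rw [Real.mul_rpow (by norm_num) hy.le]
      have f1 : y ^ (-(1 - b)) = y⁻¹ * y ^ b := by
        rw [← Real.rpow_neg_one, ← Real.rpow_add hy]; ring_nf
      have f2 : y ^ (-(a - b)) = y ^ (-a) * y ^ b := by
        rw [← Real.rpow_add hy]; ring_nf
      rw [f1, f2] at hN
      have h2 : (0 : ℝ) < 2 ^ b := by positivity
      have hyb : (0 : ℝ) < y ^ b := by positivity
      rw [Real.rpow_neg zero_le_two, Real.rpow_neg hy.le b, ← mul_inv, ← one_div,
        le_div_iff₀ (by positivity), div_eq_mul_inv]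
      linarith
    have e3 : 0 ≤ 4 / y * y ^ (-a) := by positivity
    simp only [hq]
    push_cast
    push_cast at e1
    have hyy : (N : ℝ) + 1 = y := by rw [hydef]; push_cast; rfl
    rw [hyy]
    nlinarith
  obtain ⟨N₀, hN₀⟩ := eventually_atTop.1 hlarge
  -- For the finitely many remaining `N` the success probability is positive, while the required
  -- bound tends to `0` as `a' → 0`; a small enough `a'` serves them all.
  have hsmall : ∀ᶠ a' : ℝ in nhdsWithin 0 (Set.Ioi 0), ∀ N ∈ Finset.range N₀, 4 ≤ N →
      1 - (((N + 2 : ℕ) : ℝ)) ^ (-a') ≤ q N := by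
    rw [Filter.eventually_all_finset]
    intro N _
    by_cases hN : 4 ≤ N
    · have hc : Continuous (fun a' : ℝ => 1 - (((N + 2 : ℕ) : ℝ)) ^ (-a')) :=
        continuous_const.sub (Real.continuous_const_rpow (by positivity) |>.comp continuous_neg)
      have ht : Tendsto (fun a' : ℝ => 1 - (((N + 2 : ℕ) : ℝ)) ^ (-a'))
          (nhdsWithin 0 (Set.Ioi 0)) (nhds 0) := by
        have := (hc.tendsto 0).mono_left (nhdsWithin_le_nhds (s := Set.Ioi 0))
        simpa using this
      filter_upwards [ht.eventually_lt_const (hqpos N hN)] with a' h _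
      exact h.le
    · exact Eventually.of_forall fun _ h => absurd h hN
  have hle : ∀ᶠ a' : ℝ in nhdsWithin 0 (Set.Ioi 0), a' < b :=
    nhdsWithin_le_nhds (eventually_lt_nhds hb0)
  obtain ⟨a', h1, h2, h3⟩ := (hsmall.and (hle.and self_mem_nhdsWithin)).exists
  refine ⟨a', h3, fun N hN => ?_⟩
  by_cases h : N < N₀
  · exact h1 N (Finset.mem_range.2 h) hN
  · refine le_trans ?_ (hN₀ N (not_lt.1 h))
    have : (((N + 2 : ℕ) : ℝ)) ^ (-b) ≤ (((N + 2 : ℕ) : ℝ)) ^ (-a') :=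
      Real.rpow_le_rpow_of_exponent_le (by push_cast; linarith [Nat.cast_nonneg (α := ℝ) N])
        (by linarith)
    linarith

/-! ### The cycle protocol and the lower bound -/

open Classical in
/-- The protocol for the cycle problem that deletes the last vertex, redirects its edges to a random
vertex, and verifies that the remaining edges form a minimum spanning forest. -/
noncomputable def cycleProtocol (A : ∀ n _m : ℕ, Protocol (Sym2 (Fin n) × ℕ × Bool)) :
    ∀ n : ℕ, Protocol (Sym2 (Fin n))
  -- Placeholders: the cycle problem is posed only for at least six vertices.
  | 0 => (A 0 0).precompose 1 one_pos fun _ _ => ∅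
  | 1 => (A 0 0).precompose 1 one_pos fun _ _ => ∅
  | N + 2 => (A (N + 1) (N + 2)).precompose (N + 1) N.succ_pos fun x Y =>
      Y.image (redirectRecord x)

open Classical in
/-- The largest number of rounds on the verification inputs obtained from a graph. -/
noncomputable def cycleRounds {κ : ℕ} (r : ∀ n : ℕ, VerificationInput κ n → ℕ) :
    ∀ n : ℕ, SimpleGraph (Fin n) → ℕ
  | 0, _ => 0
  | 1, _ => 0
  | N + 2, G =>
      if h : (G.comap Fin.castSucc).edgeFinset.card = N then
        Finset.univ.sup fun x : Fin (N + 1) => r (N + 1) (redirectInput κ G h x)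
      else 0

theorem withinResources_cycleProtocol {δ : ℝ} (hδ : 0 < δ) {C k : ℕ}
    {A : ∀ n _m : ℕ, Protocol (Sym2 (Fin n) × ℕ × Bool)}
    (hA : ∀ᶠ n in atTop, ∀ m ≤ n ^ 2, (A n m).WithinResources δ C k n) :
    ∀ᶠ n in atTop, (cycleProtocol A n).WithinResources δ C k n := by
  obtain ⟨n₀, h₀⟩ := eventually_atTop.1 hA
  filter_upwards [eventually_ge_atTop (n₀ + 3)] with n hn
  obtain ⟨N, rfl⟩ := Nat.exists_eq_add_of_le' (show 2 ≤ n by omega)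
  -- The instance has `N + 1` vertices and `N + 2` edges, and `N + 2 ≤ (N + 1) ^ 2` once `N ≥ 1`.
  obtain ⟨h1, h2, h3⟩ := h₀ (N + 1) (by omega) (N + 2) (by nlinarith [show 1 ≤ N by omega])
  have hpow : C * (N + 1) ^ k ≤ C * (N + 2) ^ k := by gcongr; omega
  refine ⟨h1.trans ?_, h2.trans hpow, h3.trans hpow⟩
  gcongr
  omega

open Classical in
theorem distinguishesCycles_cycleProtocol {κ : ℕ}
    {A : ∀ n _m : ℕ, Protocol (Sym2 (Fin n) × ℕ × Bool)}
    {r : ∀ n : ℕ, VerificationInput κ n → ℕ} (hr : VerifiesMSF κ A r) :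
    DistinguishesCycles (cycleProtocol A) (cycleRounds r) := by
  obtain ⟨a, ha, hdec⟩ := hr
  obtain ⟨a', ha', herr⟩ := exists_rpow_error ha
  refine ⟨a', ha', fun k hk => ?_⟩
  -- Replacing `2 * k` by a variable allows the substitution `n = N + 2`, the pattern on which the
  -- protocol is defined.
  suffices H : ∀ n, 2 * k = n → ∀ G : SimpleGraph (Fin n),
      IsOneCycle G ∨ Nonempty (G ≃g (cycleGraph k ⊕g cycleGraph k)) →
      (cycleProtocol A n).Decides G.edgeFinset (IsOneCycle G) (cycleRounds r n G)
        ((n : ℝ) ^ (-a')) from fun G hG => H _ rfl G hG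
  intro n hn G hG
  obtain ⟨N, rfl⟩ := Nat.exists_eq_add_of_le' (show 2 ≤ n by omega)
  obtain ⟨hreg, -, hac, hconn⟩ := cycles_delete_last hk hn G hG
  obtain ⟨hcard, hcard'⟩ := card_edgeFinset_comap_castSucc hreg
  obtain ⟨S, hS, hS'⟩ := exists_good_targets hreg
  refine Protocol.Decides.precompose (b := 4) (ε := ((N + 1 : ℕ) : ℝ) ^ (-a)) N.succ_pos
    redirectRecord S hS' (by omega) ?_ ?_ ?_ (herr N (by omega))
  · exact Real.rpow_le_one_of_one_le_of_nonpos (by push_cast; linarith [N.cast_nonneg (α := ℝ)])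
      (by linarith)
  · intro x hx
    rw [coe_edgeFinset]
    exact injOn_redirectRecord x
  · intro x hx
    have hrec := (hS x hx).records_redirectInput (κ := κ) hcard
    have h := hdec (N + 1) (redirectInput κ G hcard x)
    rw [isMinimumSpanningForest_redirectInput hcard (fun h => hconn (hac.1 h)), hac, hrec,
      Finset.card_image_of_injOn (by
        rw [coe_edgeFinset]; exact injOn_redirectRecord x), hcard'] at h
    refine h.mono_rounds ?_
    rw [cycleRounds, dif_pos hcard]
    exact Finset.le_sup (f := fun x => r (N + 1) (redirectInput κ G hcard x)) (Finset.mem_univ x)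

theorem theorem5p1 (hconj : OneVsTwoCycleConjecture)
    (δ : ℝ) (hδ0 : 0 < δ) (hδ1 : δ < 1) (κ : ℕ)
    (A : ∀ n _m : ℕ, Protocol (Sym2 (Fin n) × ℕ × Bool))
    (hA : ∃ C k : ℕ, ∀ᶠ n in atTop, ∀ m ≤ n ^ 2, (A n m).WithinResources δ C k n)
    (r : ∀ n : ℕ, VerificationInput κ n → ℕ)
    (hr : VerifiesMSF κ A r) :
    ∃ c : ℝ, 0 < c ∧ ∀ᶠ d : ℕ in atTop,
      ∃ n ≤ 3 * d, ∃ I : VerificationInput κ n,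
        d ≤ I.diamT ∧ c * Real.log (I.diamT : ℝ) ≤ (r n I : ℝ) := by
  classical
  obtain ⟨C, k, hA⟩ := hA
  obtain ⟨c, hc, hlow⟩ := hconj δ hδ0 hδ1 (cycleProtocol A) (cycleRounds r)
    ⟨C, k, withinResources_cycleProtocol hδ0 hA⟩ (distinguishesCycles_cycleProtocol hr)
  refine ⟨c, hc, ?_⟩
  -- Cycles of length `d + 2` leave a path of length at least `d` after the deletion; the instance
  -- has `2 * d + 3` vertices, at most `3 * d` when `d ≥ 3`.
  filter_upwards [(tendsto_add_atTop_nat 2).eventually hlow, eventually_ge_atTop 3] with d hd hd3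
  obtain ⟨N, hN⟩ : ∃ N, 2 * (d + 2) = N + 2 := ⟨2 * d + 2, by ring⟩
  have hd' : ∃ G : SimpleGraph (Fin (N + 2)),
      (IsOneCycle G ∨ Nonempty (G ≃g (cycleGraph (d + 2) ⊕g cycleGraph (d + 2)))) ∧
      c * Real.log ((N + 2 : ℕ) : ℝ) ≤ (cycleRounds r (N + 2) G : ℝ) := by
    rw [← hN]
    exact hd
  obtain ⟨G, hG, hround⟩ := hd'
  obtain ⟨hreg, ⟨u, v, huv⟩, -, -⟩ := cycles_delete_last (by omega) hN G hG
  have hcard := (card_edgeFinset_comap_castSucc hreg).1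
  rw [cycleRounds, dif_pos hcard] at hround
  -- The slowest target may be a bad one. This is harmless: `redirectInput` is a legitimate input
  -- for every `x`, with the same `T`.
  obtain ⟨x, -, hx⟩ := Finset.exists_mem_eq_sup Finset.univ Finset.univ_nonempty
    (fun x : Fin (N + 1) => r (N + 1) (redirectInput κ G hcard x))
  rw [hx] at hround
  have hdiam : d ≤ (redirectInput κ G hcard x).diamT :=
    huv.trans (le_diamT_redirectInput hcard u v)
  refine ⟨N + 1, by omega, redirectInput κ G hcard x, hdiam, le_trans ?_ hround⟩
  have h1 : (0 : ℝ) < ((redirectInput κ G hcard x).diamT : ℝ) := by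
    exact_mod_cast (show 0 < (redirectInput κ G hcard x).diamT by omega)
  have h2 : ((redirectInput κ G hcard x).diamT : ℝ) ≤ ((N + 2 : ℕ) : ℝ) := by
    exact_mod_cast (redirectInput κ G hcard x).diamT_le.trans (Nat.le_succ _)
  gcongr
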